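/- All rings are commutative with identity. Let $V$ be a valuation ring (an integral domain in which, of any two elements, one divides the other), let $X=\operatorname{Spec}V$ with the Zariski topology, let $Z\subseteq X$ be a closed subset, and let $U=X\setminus Z$. For a sheaf $\mathcal F$ of abelian groups on $X$ put $$\Gamma_Z(\mathcal F)=\ker\bigl(\mathrm{res}^X_U:\mathcal F(X)\to\mathcal F(U)\bigr),$$ and let $H^i\Gamma_Z$ denote the $i$-th right derived functor of the left exact functor $\Gamma_Z$ from sheaves of abelian groups on $X$ to abelian groups. Then for every sheaf $\mathcal F$ of abelian groups on $X$: 1. there is an isomorphism of abelian groups $H^i\Gamma_Z(\mathcal F)\cong H^{i-1}(U,\mathcal F|_U)$ for every $i>1$, where the right-hand side is sheaf cohomology on $U$, and $H^1\Gamma_Z(\mathcal F)\cong\operatorname{coker}\bigl(\mathrm{res}^X_U:\mathcal F(X)\to\mathcal F(U)\bigr)$; 2. if $V$ has finite Krull dimension or if $U$ is quasi-compact, then $H^i\Gamma_Z(\mathcal F)=0$ for every $i>1$. -/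

import Mathlib

open CategoryTheory TopologicalSpace Opposite

universe u

noncomputable section

/-- The restriction map `res^X_U : F(X) ⟶ F(U)` of an abelian sheaf on a space `X`. -/
def globalRes {X : TopCat.{u}} (U : Opens X) (F : TopCat.Sheaf AddCommGrpCat.{u} X) :
    F.obj.obj (op ⊤) ⟶ F.obj.obj (op U) :=
  F.obj.map (homOfLE (le_top : U ≤ ⊤)).op

/-- The functor `Γ_Z` of global sections with support in the closed set `Z`:
`Γ_Z(F)` is the kernel of `F(X) ⟶ F(X - Z)`. -/
def sectionsWithSupport {X : TopCat.{u}} (Z : Closeds X) :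
    TopCat.Sheaf AddCommGrpCat.{u} X ⥤ AddCommGrpCat.{u} where
  obj F := AddCommGrpCat.of (globalRes Z.compl F).hom.ker
  map {F G} φ := AddCommGrpCat.ofHom
    (((φ.hom.app (op ⊤)).hom.comp (globalRes Z.compl F).hom.ker.subtype).codRestrict
      (globalRes Z.compl G).hom.ker (fun s => by
        have h := ConcreteCategory.congr_hom
          (φ.hom.naturality (homOfLE (le_top : Z.compl ≤ ⊤)).op) s.1
        have hs : F.obj.map (homOfLE (le_top : Z.compl ≤ ⊤)).op s.1 = 0 := s.2
        change G.obj.map (homOfLE (le_top : Z.compl ≤ ⊤)).op (φ.hom.app (op ⊤) s.1) = 0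
        rw [ConcreteCategory.comp_apply, ConcreteCategory.comp_apply, hs, map_zero] at h
        exact h.symm))

instance sectionsWithSupport_additive {X : TopCat.{u}} (Z : Closeds X) : (sectionsWithSupport Z).Additive where
  map_add := rfl

/-- Local cohomology `H^iΓ_Z`: the `i`-th right derived functor of `Γ_Z`. -/
def sheafLocalCohomology {X : TopCat.{u}} (Z : Closeds X) (i : ℕ) :
    TopCat.Sheaf AddCommGrpCat.{u} X ⥤ AddCommGrpCat.{u} :=
  (sectionsWithSupport Z).rightDerived i

end

noncomputable section

/-! The maximal ideal of `V` is a point of `X` whose only open neighbourhood is `X`, so taking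
global sections is exact. Let `I` be an injective resolution of `F` with cycles `Zⁿ`, so that `0 →
Zⁿ → Iⁿ → Zⁿ⁺¹ → 0` is exact and `Iⁿ` is flasque. A diagram chase gives `Hⁿ⁺¹Γ_Z(F) ≅ coker(Zⁿ(X) →
Zⁿ(U))` (`nonempty_sheafLocalCohomology_addEquiv`). As `Z⁰ ≅ F`, the case `n = 0` is the statement
about `H¹Γ_Z`.

The images of `Zⁿ⁺¹(X)` and `Iⁿ(U)` in `Zⁿ⁺¹(U)` agree, both being the image of `Iⁿ(X)`. Hence the
cokernel for `Zⁿ⁺¹` is `H¹(U, Zⁿ)` (`nonempty_coker_addEquiv_H_one`), and dimension shifting turns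
this into `Hⁿ⁺¹(U, F)`.

For the vanishing, the primes of `V` form a chain. Finite dimension or quasi-compactness gives a
nonempty `U` a largest prime, whose only neighbourhood in `U` is `U`, so the higher cohomology of
`U` is zero. -/

/-- Two surjections from the same additive group with the same kernel have isomorphic targets. -/
lemma nonempty_addEquiv_of_ker_eq {P M N : Type*} [AddCommGroup P] [AddCommGroup M]
    [AddCommGroup N] (f : P →+ M) (g : P →+ N) (hf : Function.Surjective f)
    (hg : Function.Surjective g) (h : ∀ x, f x = 0 ↔ g x = 0) : Nonempty (M ≃+ N) := by
  have hk : f.ker = g.ker := by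
    ext x
    simp [AddMonoidHom.mem_ker, h]
  exact ⟨(QuotientAddGroup.quotientKerEquivOfSurjective f hf).symm.trans
    ((QuotientAddGroup.quotientAddEquivOfEq hk).trans
      (QuotientAddGroup.quotientKerEquivOfSurjective g hg))⟩

/-! ### Flasque sheaves and restriction to open subsets -/

namespace TopCat.Sheaf

variable {X : TopCat.{u}}

/-- Injective abelian sheaves are flasque. -/
lemma isFlasque_of_injective (F : TopCat.Sheaf AddCommGrpCat.{u} X) [Injective F] :
    IsFlasque F where
  epi {A B} i := by
    rw [AddCommGrpCat.epi_iff_surjective]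
    intro s
    let J := Opens.grothendieckTopology X
    let j : (yoneda.obj B.unop) ⟶ (yoneda.obj A.unop) := yoneda.map i.unop
    -- `L` sends the presheaf represented by an open `W` to the free abelian sheaf on it; by
    -- adjunction and Yoneda, maps from that sheaf to `F` are sections of `F` over `W`. Extending a
    -- section thus means extending a map along the monomorphism `L.map j`.
    let L : ((Opens X)ᵒᵖ ⥤ Type u) ⥤ TopCat.Sheaf AddCommGrpCat.{u} X :=
      (Functor.whiskeringRight (Opens X)ᵒᵖ _ _).obj AddCommGrpCat.free.{u} ⋙
      presheafToSheaf J AddCommGrpCat.{u}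
    let R : TopCat.Sheaf AddCommGrpCat.{u} X ⥤ ((Opens X)ᵒᵖ ⥤ Type u) := sheafToPresheaf J _ ⋙
      (Functor.whiskeringRight (Opens X)ᵒᵖ _ _).obj (CategoryTheory.forget AddCommGrpCat.{u})
    let adj : L ⊣ R := (AddCommGrpCat.adj.{u}.whiskerRight (Opens X)ᵒᵖ).comp
      (sheafificationAdjunction J AddCommGrpCat.{u})
    have : Mono (((Functor.whiskeringRight (Opens X)ᵒᵖ _ _).obj AddCommGrpCat.free.{u}).map j) := by
      have (V : (Opens X)ᵒᵖ) : Mono ((((Functor.whiskeringRight (Opens X)ᵒᵖ _ _).obj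
          AddCommGrpCat.free.{u}).map j).app V) := by
        change Mono (AddCommGrpCat.free.map (j.app V))
        infer_instance
      exact NatTrans.mono_of_mono_app _
    have : Mono (L.map j) := by
      exact (presheafToSheaf J AddCommGrpCat.{u}).map_mono
        (((Functor.whiskeringRight (Opens X)ᵒᵖ _ _).obj AddCommGrpCat.free.{u}).map j)
    let φ : L.obj (yoneda.obj B.unop) ⟶ F :=
      (adj.homEquiv _ F).symm (yonedaEquiv.symm s)
    let ψ := Injective.factorThru φ (L.map j)
    have h : L.map j ≫ ψ = φ := Injective.comp_factorThru _ _
    refine ⟨yonedaEquiv (adj.homEquiv _ F ψ), ?_⟩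
    have h2 : j ≫ adj.homEquiv _ F ψ = yonedaEquiv.symm s := by
      rw [← adj.homEquiv_naturality_left, h]
      exact Equiv.apply_symm_apply _ _
    have h3 := congrArg yonedaEquiv h2
    rw [Equiv.apply_symm_apply] at h3
    rw [← h3]
    exact yonedaEquiv_naturality' (adj.homEquiv _ F ψ) i

/-- Restriction of abelian sheaves to an open subset, as a functor to sheaves on the open subset
regarded as an object of `TopCat`. -/
def restrictOpens (U : Opens X) :
    TopCat.Sheaf AddCommGrpCat.{u} X ⥤ TopCat.Sheaf AddCommGrpCat.{u} (TopCat.of U) :=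
  U.sheafRestrict

instance (U : Opens X) : (restrictOpens U).IsRightAdjoint :=
  inferInstanceAs (U.sheafRestrict (C := AddCommGrpCat.{u})).IsRightAdjoint

instance (U : Opens X) : (restrictOpens U).PreservesZeroMorphisms :=
  Functor.preservesZeroMorphisms_of_isRightAdjoint _

lemma map_map_apply (F : TopCat.Sheaf AddCommGrpCat.{u} X) {A B C : Opens X} (h : A ≤ B)
    (h' : B ≤ C) (s : F.obj.obj (op C)) :
    F.obj.map (homOfLE h).op (F.obj.map (homOfLE h').op s) =
      F.obj.map (homOfLE (h.trans h')).op s := by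
  rw [← ConcreteCategory.comp_apply, ← Functor.map_comp]
  rfl

lemma naturality_apply {F G : TopCat.Sheaf AddCommGrpCat.{u} X} (f : F ⟶ G) {A B : Opens X}
    (h : A ≤ B) (s : F.obj.obj (op B)) :
    f.hom.app (op A) (F.obj.map (homOfLE h).op s) =
      G.obj.map (homOfLE h).op (f.hom.app (op B) s) :=
  ConcreteCategory.congr_hom (f.hom.naturality (homOfLE h).op) s

/-- Restriction to an open subset preserves epimorphisms of abelian sheaves. -/
instance (U : Opens X) : (restrictOpens U).PreservesEpimorphisms where
  preserves {F G} g hg := by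
    refine (isLocallySurjective_iff_epi _).mp ?_
    have := (isLocallySurjective_iff_epi g).mpr hg
    refine (Presheaf.isLocallySurjective_iff _).mpr fun W t x hx ↦ ?_
    obtain ⟨W', hW', ⟨s, hs⟩, hx'⟩ := (Presheaf.isLocallySurjective_iff g.hom).mp this
      (U.isOpenEmbedding.isOpenMap.functor.obj W) t x.1 ⟨x, hx, rfl⟩
    let W'' : Opens U := (Opens.map U.inclusion').obj W'
    have e : U.isOpenEmbedding.isOpenMap.functor.obj W'' ≤ W' := by
      rintro _ ⟨y, hy, rfl⟩
      exact hy
    refine ⟨W'', fun y hy ↦ ?_, ⟨F.obj.map (homOfLE e).op s, ?_⟩, hx'⟩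
    · obtain ⟨z, hz, hzy⟩ := hW' hy
      obtain rfl : z = y := Subtype.ext hzy
      exact hz
    · refine (naturality_apply g e s).trans ?_
      rw [hs]
      exact map_map_apply G e hW' t

/-- Restriction to an open subset preserves short exact sequences of abelian sheaves. -/
lemma shortExact_map_restrictOpens (U : Opens X)
    {S : ShortComplex (TopCat.Sheaf AddCommGrpCat.{u} X)} (hS : S.ShortExact) :
    (S.map (restrictOpens U)).ShortExact := by
  have := hS.mono_f
  have := hS.epi_g
  have : Limits.PreservesLimits (restrictOpens U) :=
    (Adjunction.ofIsRightAdjoint _).rightAdjoint_preservesLimits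
  exact
    { exact := hS.exact.map_of_mono_of_preservesKernel _ inferInstance inferInstance
      mono_f := inferInstanceAs (Mono ((restrictOpens U).map S.f))
      epi_g := inferInstanceAs (Epi ((restrictOpens U).map S.g)) }

instance isFlasque_restrictOpens (U : Opens X) (F : TopCat.Sheaf AddCommGrpCat.{u} X)
    [IsFlasque F] : IsFlasque ((restrictOpens U).obj F) where
  epi i := Presheaf.IsFlasque.epi (F := F.obj) (U.isOpenEmbedding.isOpenMap.functor.op.map i)

end TopCat.Sheaf
-- Connecting maps, dimension shifting and acyclicity
namespace CategoryTheory.Sheaf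

open Abelian

section Site

universe w' w v₁ u₁

variable {C : Type u₁} [Category.{v₁} C] {J : GrothendieckTopology C}
  [HasSheafify J AddCommGrpCat.{w}] [HasExt.{w'} (Sheaf J AddCommGrpCat.{w})]
  {S : ShortComplex (Sheaf J AddCommGrpCat.{w})} {T : C} (hT : Limits.IsTerminal T)

/-- Isomorphic abelian sheaves have isomorphic cohomology. -/
def hAddEquivOfIso {F G : Sheaf J AddCommGrpCat.{w}} (e : F ≅ G) (n : ℕ) :
    Sheaf.H F n ≃+ Sheaf.H G n :=
  ((functorH J n).mapIso e).addCommGroupIsoToAddEquiv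

/-- The connecting homomorphism from sections over a terminal object to first cohomology. -/
def connectingHom (hS : S.ShortExact) :
    S.X₃.obj.obj (op T) →+ Sheaf.H S.X₁ 1 :=
  (hS.extClass.postcomp _ (zero_add 1)).comp
    (Sheaf.H.equiv₀ S.X₃ hT).symm.toAddMonoidHom

/-- Together with `connectingHom_surjective`, this presents `H¹(S.X₁)` as the cokernel of `S.X₂(T) →
S.X₃(T)` when `H¹(S.X₂)` vanishes. -/
lemma connectingHom_eq_zero_iff (hS : S.ShortExact) (s : S.X₃.obj.obj (op T)) :
    connectingHom hT hS s = 0 ↔ ∃ t : S.X₂.obj.obj (op T), S.g.hom.app (op T) t = s := by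
  constructor
  · intro h
    obtain ⟨y, hy⟩ := Ext.covariant_sequence_exact₃ _ hS
      ((Sheaf.H.equiv₀ S.X₃ hT).symm s) (zero_add 1) h
    refine ⟨Sheaf.H.equiv₀ S.X₂ hT y, ?_⟩
    rw [Sheaf.H.equiv₀_naturality, Sheaf.H.map_apply, hy]
    exact AddEquiv.apply_symm_apply _ _
  · rintro ⟨t, rfl⟩
    change ((Sheaf.H.equiv₀ S.X₃ hT).symm _).comp hS.extClass (zero_add 1) = 0
    rw [← Sheaf.H.equiv₀_symm_naturality, Sheaf.H.map_apply]
    simp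

lemma connectingHom_surjective (hS : S.ShortExact) [Subsingleton (Sheaf.H S.X₂ 1)] :
    Function.Surjective (connectingHom hT hS) := by
  intro x
  obtain ⟨y, hy⟩ := Ext.covariant_sequence_exact₁ _ hS x
    (Subsingleton.elim (α := Sheaf.H S.X₂ 1) _ _) (zero_add 1)
  refine ⟨Sheaf.H.equiv₀ S.X₃ hT y, ?_⟩
  change ((Sheaf.H.equiv₀ S.X₃ hT).symm _).comp hS.extClass (zero_add 1) = x
  rw [AddEquiv.symm_apply_apply, hy]

lemma nonempty_H_succ_addEquiv (hS : S.ShortExact) (n : ℕ) [Subsingleton (Sheaf.H S.X₂ n)]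
    [Subsingleton (Sheaf.H S.X₂ (n + 1))] :
    Nonempty (Sheaf.H S.X₃ n ≃+ Sheaf.H S.X₁ (n + 1)) := by
  refine ⟨AddEquiv.ofBijective (hS.extClass.postcomp _ rfl) ⟨?_, fun x ↦ ?_⟩⟩
  · rw [injective_iff_map_eq_zero]
    intro x hx
    obtain ⟨y, rfl⟩ := Ext.covariant_sequence_exact₃ _ hS x rfl hx
    rw [Subsingleton.elim (α := Sheaf.H S.X₂ n) y 0, Ext.zero_comp]
  · exact Ext.covariant_sequence_exact₁ _ hS x
      (Subsingleton.elim (α := Sheaf.H S.X₂ (n + 1)) _ _) rfl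

/-- Vanishing of higher cohomology for a class of abelian sheaves that is stable under the formation
of cokernels of embeddings into injective sheaves, when these cokernels lift global sections. -/
lemma subsingleton_H_of_class [EnoughInjectives (Sheaf J AddCommGrpCat.{w})]
    (hT : Limits.IsTerminal T) (P : Sheaf J AddCommGrpCat.{w} → Prop)
    (hP : ∀ S : ShortComplex (Sheaf J AddCommGrpCat.{w}), S.ShortExact → P S.X₁ →
      Injective S.X₂ → P S.X₃ ∧ Function.Surjective (S.g.hom.app (op T)))
    (n : ℕ) (F : Sheaf J AddCommGrpCat.{w}) (hF : P F) :
    Subsingleton (Sheaf.H F (n + 1)) := by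
  induction n generalizing F with
  | zero =>
    let I := Classical.arbitrary (InjectivePresentation F)
    have := I.injective
    obtain ⟨-, h⟩ := hP I.shortComplex I.shortExact_shortComplex hF I.injective
    have : Subsingleton (Sheaf.H I.shortComplex.X₂ (0 + 1)) :=
      inferInstanceAs (Subsingleton (Sheaf.H I.J (0 + 1)))
    refine subsingleton_of_forall_eq 0 fun x ↦ ?_
    obtain ⟨y, rfl⟩ := connectingHom_surjective hT I.shortExact_shortComplex x
    exact (connectingHom_eq_zero_iff hT _ _).mpr (h y)
  | succ n ih =>
    let I := Classical.arbitrary (InjectivePresentation F)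
    have := I.injective
    obtain ⟨h, -⟩ := hP I.shortComplex I.shortExact_shortComplex hF I.injective
    have : Subsingleton (Sheaf.H I.shortComplex.X₂ (n + 1)) :=
      inferInstanceAs (Subsingleton (Sheaf.H I.J (n + 1)))
    have : Subsingleton (Sheaf.H I.shortComplex.X₂ (n + 1 + 1)) :=
      inferInstanceAs (Subsingleton (Sheaf.H I.J (n + 1 + 1)))
    -- The cokernel is again in the class, and its cohomology one degree lower is that of `F`.
    have := ih _ h
    obtain ⟨e⟩ := nonempty_H_succ_addEquiv I.shortExact_shortComplex (n + 1)
    exact e.symm.toEquiv.subsingleton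

end Site

variable {X : TopCat.{u}}

/-- Flasque abelian sheaves are acyclic. -/
instance subsingleton_H_of_isFlasque (F : Sheaf (Opens.grothendieckTopology X) AddCommGrpCat.{u})
    [hF : TopCat.Sheaf.IsFlasque F]
    (n : ℕ) :
    Subsingleton (Sheaf.H F (n + 1)) := by
  refine subsingleton_H_of_class Limits.isTerminalTop (fun F ↦ TopCat.Sheaf.IsFlasque F)
    (fun S hS h1 h2 ↦ ?_) n F hF
  have := @TopCat.Sheaf.isFlasque_of_injective X S.X₂ h2
  exact ⟨TopCat.Sheaf.IsFlasque.of_shortExact_of_isFlasque₁₂ hS,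
    (AddCommGrpCat.epi_iff_surjective _).mp (TopCat.Sheaf.IsFlasque.epi_of_shortExact hS)⟩

/-- An epimorphism of abelian sheaves is surjective on global sections if the space has a point
whose only open neighbourhood is the whole space. -/
lemma surjective_app_top_of_epi {F G : Sheaf (Opens.grothendieckTopology X) AddCommGrpCat.{u}}
    (g : F ⟶ G) (hg : Epi g) {x : X} (hx : ∀ W : Opens X, x ∈ W → W = ⊤) :
    Function.Surjective (g.hom.app (op ⊤)) := by
  intro t
  obtain ⟨W, hW, ⟨s, hs⟩, hxW⟩ := (TopCat.Presheaf.isLocallySurjective_iff g.hom).mp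
    ((TopCat.Sheaf.isLocallySurjective_iff_epi g).mpr hg) ⊤ t x (Opens.mem_top x)
  obtain rfl := hx W hxW
  refine ⟨s, hs.trans ?_⟩
  change G.obj.map (𝟙 (op ⊤)) t = t
  simp

/-- The higher cohomology of a space with a point whose only open neighbourhood is the whole space
vanishes. -/
lemma subsingleton_H_of_point {x : X} (hx : ∀ W : Opens X, x ∈ W → W = ⊤)
    (F : Sheaf (Opens.grothendieckTopology X) AddCommGrpCat.{u}) (n : ℕ) :
    Subsingleton (Sheaf.H F (n + 1)) := by
  refine subsingleton_H_of_class Limits.isTerminalTop (fun _ ↦ True)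
    (fun S hS _ _ ↦ ⟨True.intro, ?_⟩) n F True.intro
  exact surjective_app_top_of_epi S.g hS.epi_g hx

/-- The higher cohomology of an empty space vanishes. -/
lemma subsingleton_H_of_isEmpty [IsEmpty X]
    (F : Sheaf (Opens.grothendieckTopology X) AddCommGrpCat.{u}) (n : ℕ) :
    Subsingleton (Sheaf.H F (n + 1)) := by
  refine subsingleton_H_of_class Limits.isTerminalTop (fun _ ↦ True)
    (fun S hS _ _ ↦ ⟨True.intro, fun s ↦ ⟨0, ?_⟩⟩) n F
    True.intro
  have := AddCommGrpCat.subsingleton_of_isZero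
    ((Limits.isZero_zero AddCommGrpCat.{u}).of_iso ((TopCat.Sheaf.isTerminalOfEqEmpty (X := X) S.X₃ (U := ⊤)
      (Opens.ext (Set.eq_empty_of_isEmpty _))).uniqueUpToIso (Limits.isZero_zero _).isTerminal))
  exact Subsingleton.elim _ _

end CategoryTheory.Sheaf

/-! ### Cycles of a cochain complex -/

namespace HomologicalComplex

variable {C : Type*} [Category* C] [Abelian C] (K : CochainComplex C ℕ)

/-- The short complex `Zⁿ ⟶ Kⁿ ⟶ Zⁿ⁺¹` of a cochain complex. -/
@[simps]
def cyclesShortComplex (n : ℕ) : ShortComplex C where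
  X₁ := K.cycles n
  X₂ := K.X n
  X₃ := K.cycles (n + 1)
  f := K.iCycles n
  g := K.toCycles n (n + 1)
  zero := by
    rw [← cancel_mono (K.iCycles (n + 1))]
    simp

/-- The cokernel of `Kⁿ ⟶ Zⁿ⁺¹` is the homology in degree `n + 1`, so only exactness there is
needed; the kernel is that of the differential because `Zⁿ⁺¹ ⟶ Kⁿ⁺¹` is mono. -/
lemma cyclesShortComplex_shortExact (n : ℕ) (h : K.ExactAt (n + 1)) :
    (cyclesShortComplex K n).ShortExact where
  exact := by
    have hl := K.cyclesIsKernel n (n + 1) (by simp)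
    refine ShortComplex.exact_of_f_is_kernel _
      (Limits.KernelFork.IsLimit.ofι _ _ (fun k hk ↦ hl.lift (Limits.KernelFork.ofι k ?_))
        (fun k hk ↦ hl.fac (Limits.KernelFork.ofι k _) Limits.WalkingParallelPair.zero)
        (fun k hk m hm ↦ ?_))
    · change k ≫ K.d n (n + 1) = 0
      rw [← K.toCycles_i n (n + 1)]
      exact (Category.assoc _ _ _).symm.trans
        ((congrArg (· ≫ K.iCycles (n + 1)) hk).trans Limits.zero_comp)
    · refine (cancel_mono (K.iCycles n)).mp (hm.trans (Eq.symm ?_))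
      exact hl.fac (Limits.KernelFork.ofι k _) Limits.WalkingParallelPair.zero
  mono_f := inferInstanceAs (Mono (K.iCycles n))
  epi_g := Preadditive.epi_of_isZero_cokernel' _ (K.homologyIsCokernel n (n + 1) (by simp))
    ((K.exactAt_iff_isZero_homology (n + 1)).mp h)

end HomologicalComplex

/-- The object resolved by an injective resolution is the object of zero-cycles. -/
def CategoryTheory.InjectiveResolution.isoCyclesZero {C : Type*} [Category* C] [Abelian C] {F : C}
    (I : InjectiveResolution F) : F ≅ I.cocomplex.cycles 0 :=
  I.isLimitKernelFork.conePointUniqueUpToIso (I.cocomplex.cyclesIsKernel 0 1 (by simp))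

/-! ### Local cohomology and cohomology of `U` as cokernels of restriction -/

namespace TopCat.Sheaf
variable {X : TopCat.{u}}

lemma exact_sections {A B C : TopCat.Sheaf AddCommGrpCat.{u} X} (f : A ⟶ B) (g : B ⟶ C) [Mono f]
    (w : f ≫ g = 0) (h : (ShortComplex.mk f g w).Exact) {U : Opens X} (b : B.obj.obj (op U)) :
    g.hom.app (op U) b = 0 ↔ ∃ a : A.obj.obj (op U), f.hom.app (op U) a = b := by
  constructor
  · exact Sheaf.sections_exact_of_left_exact h inferInstance b
  · rintro ⟨a, rfl⟩
    change (f ≫ g).hom.app (op U) a = 0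
    rw [w]
    rfl

lemma injective_app {A B : TopCat.Sheaf AddCommGrpCat.{u} X} (f : A ⟶ B) [Mono f] (U : Opens X) :
    Function.Injective (f.hom.app (op U)) := by
  have : Mono f.hom := (TopCat.Sheaf.forget AddCommGrpCat.{u} X).map_mono f
  exact (AddCommGrpCat.mono_iff_injective _).mp inferInstance

/-- The homology of the complex of sections with support in `Z` of `T₁ ⟶ T₂ ⟶ T₃` is the cokernel
of the restriction map of the kernel `A` of the first arrow, if the restriction map of `T₁` is
surjective and `T` is exact on global sections. -/
lemma nonempty_homology_sectionsWithSupport_addEquiv (Z : Closeds X)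
    (T : ShortComplex (TopCat.Sheaf AddCommGrpCat.{u} X)) {A : TopCat.Sheaf AddCommGrpCat.{u} X}
    (f : A ⟶ T.X₁) [Mono f] (w : f ≫ T.f = 0) (hA : (ShortComplex.mk f T.f w).Exact)
    (hT : ∀ b : T.X₂.obj.obj (op ⊤), T.g.hom.app (op ⊤) b = 0 →
      ∃ a : T.X₁.obj.obj (op ⊤), T.f.hom.app (op ⊤) a = b)
    (hres : Function.Surjective (globalRes Z.compl T.X₁)) :
    Nonempty ((T.map (sectionsWithSupport Z)).homology ≃+
      A.obj.obj (op Z.compl) ⧸ (globalRes Z.compl A).hom.range) := by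
  -- `P` is the fibre product of `T₁(X)` and `A(U)` over `T₁(U)`. For `(t, s)` in `P` the section
  -- `T.f t` vanishes on `U`, as `t` comes from `A` there. So `P` maps to the cycles as well as to
  -- `A(U)`; both maps turn out surjective, and the induced maps to homology and to the cokernel
  -- have the same kernel.
  let P := AddMonoidHom.eqLocus
    ((globalRes Z.compl T.X₁).hom.comp (AddMonoidHom.fst _ (A.obj.obj (op Z.compl))))
    ((f.hom.app (op Z.compl)).hom.comp (AddMonoidHom.snd (T.X₁.obj.obj (op ⊤)) _))
  have hP (p : P) : globalRes Z.compl T.X₁ p.1.1 = f.hom.app (op Z.compl) p.1.2 := p.2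
  have hn {F G : TopCat.Sheaf AddCommGrpCat.{u} X} (g : F ⟶ G) (s : F.obj.obj (op ⊤)) :
      g.hom.app (op Z.compl) (globalRes Z.compl F s) = globalRes Z.compl G (g.hom.app (op ⊤) s) :=
    naturality_apply g le_top s
  have hg (t : T.X₁.obj.obj (op ⊤)) : T.g.hom.app (op ⊤) (T.f.hom.app (op ⊤) t) = 0 := by
    change (T.f ≫ T.g).hom.app (op ⊤) t = 0
    rw [T.zero]
    rfl
  let d : P →+ (T.map (sectionsWithSupport Z)).g.hom.ker :=
    (((T.f.hom.app (op ⊤)).hom.comp ((AddMonoidHom.fst _ _).comp P.subtype)).codRestrict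
      (globalRes Z.compl T.X₂).hom.ker (fun p ↦ by
        change globalRes Z.compl T.X₂ (T.f.hom.app (op ⊤) p.1.1) = 0
        rw [← hn, hP]
        exact (exact_sections f T.f w hA _).mpr ⟨_, rfl⟩)).codRestrict
      (T.map (sectionsWithSupport Z)).g.hom.ker (fun p ↦ Subtype.ext (hg p.1.1))
  refine Nonempty.map ((T.map (sectionsWithSupport Z)).abHomologyIso.addCommGroupIsoToAddEquiv.trans
    ·) (nonempty_addEquiv_of_ker_eq
    ((QuotientAddGroup.mk' (T.map (sectionsWithSupport Z)).abToCycles.range).comp d)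
    ((QuotientAddGroup.mk' (globalRes Z.compl A).hom.range).comp
      ((AddMonoidHom.snd _ _).comp P.subtype)) ?_ ?_ ?_)
  · refine (QuotientAddGroup.mk'_surjective _).comp ?_
    rintro ⟨⟨b, hb⟩, hb'⟩
    obtain ⟨t, ht⟩ := hT b (congrArg Subtype.val hb')
    obtain ⟨s, hs⟩ := (exact_sections f T.f w hA (globalRes Z.compl T.X₁ t)).mp (by
      rw [hn, ht]
      exact hb)
    exact ⟨⟨(t, s), hs.symm⟩, Subtype.ext (Subtype.ext ht)⟩
  · refine (QuotientAddGroup.mk'_surjective _).comp fun s ↦ ?_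
    obtain ⟨t, ht⟩ := hres (f.hom.app (op Z.compl) s)
    exact ⟨⟨(t, s), ht⟩, rfl⟩
  · intro p
    refine (QuotientAddGroup.eq_zero_iff _).trans (Iff.trans ?_
      (QuotientAddGroup.eq_zero_iff _).symm)
    constructor
    -- If `t` is supported in `Z` and has the same image as `p.1.1`, then `p.1.1 - t` is a global
    -- section of `A` restricting to `p.1.2`. Conversely, subtracting from `p.1.1` a global section
    -- of `A` that restricts to `p.1.2` leaves a section supported in `Z`.
    · rintro ⟨⟨t, ht⟩, h⟩
      have h' : T.f.hom.app (op ⊤) t = T.f.hom.app (op ⊤) p.1.1 :=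
        congrArg Subtype.val (congrArg Subtype.val h)
      obtain ⟨a, ha⟩ := (exact_sections f T.f w hA (p.1.1 - t)).mp (by
        rw [map_sub, h', sub_self])
      refine ⟨a, injective_app f _ ?_⟩
      change f.hom.app (op Z.compl) (globalRes Z.compl A a) = f.hom.app (op Z.compl) p.1.2
      rw [hn, ha, map_sub, hP]
      exact (congrArg (f.hom.app (op Z.compl) p.1.2 - ·) ht).trans (sub_zero _)
    · rintro ⟨a, ha⟩
      replace ha : globalRes Z.compl A a = p.1.2 := ha
      refine ⟨⟨p.1.1 - f.hom.app (op ⊤) a, ?_⟩, Subtype.ext (Subtype.ext ?_)⟩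
      · change globalRes Z.compl T.X₁ (p.1.1 - f.hom.app (op ⊤) a) = 0
        rw [map_sub, ← hn, ha, hP, sub_self]
      · change T.f.hom.app (op ⊤) (p.1.1 - f.hom.app (op ⊤) a) = T.f.hom.app (op ⊤) p.1.1
        rw [map_sub, (exact_sections f T.f w hA (f.hom.app (op ⊤) a)).mpr ⟨_, rfl⟩, sub_zero]

/-- If `X` has a point whose only open neighbourhood is `X`, and `S` is a short exact sequence with
flasque middle term, the first cohomology of `S.X₁` on `U` is the cokernel of the restriction map
of `S.X₃`. -/
lemma nonempty_coker_addEquiv_H_one (U : Opens X)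
    {S : ShortComplex (TopCat.Sheaf AddCommGrpCat.{u} X)} (hS : S.ShortExact) [IsFlasque S.X₂]
    {x : X} (hx : ∀ W : Opens X, x ∈ W → W = ⊤) :
    Nonempty ((S.X₃.obj.obj (op U) ⧸ (globalRes U S.X₃).hom.range) ≃+
      Sheaf.H (U.sheafRestrict.obj S.X₁) 1) := by
  have hU : U = U.isOpenEmbedding.isOpenMap.functor.obj ⊤ := by
    ext y
    simp
  let R : ShortComplex (TopCat.Sheaf AddCommGrpCat.{u} (TopCat.of U)) := S.map (restrictOpens U)
  have hR : R.ShortExact := shortExact_map_restrictOpens U hS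
  have hH : Subsingleton (Sheaf.H (U.sheafRestrict.obj S.X₂) 1) :=
    Sheaf.subsingleton_H_of_isFlasque (X := TopCat.of U) _
      (hF := isFlasque_restrictOpens U S.X₂) 0
  let δ : S.X₃.obj.obj (op (U.isOpenEmbedding.isOpenMap.functor.obj ⊤)) →+
      Sheaf.H (U.sheafRestrict.obj S.X₁) 1 :=
    Sheaf.connectingHom (J := Opens.grothendieckTopology U) (S := R)
      Limits.isTerminalTop hR
  have hδ : Function.Surjective δ :=
    @Sheaf.connectingHom_surjective _ _ (Opens.grothendieckTopology U) _ _
      R _ Limits.isTerminalTop hR hH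
  have hδ' (s : S.X₃.obj.obj (op (U.isOpenEmbedding.isOpenMap.functor.obj ⊤))) : δ s = 0 ↔
      ∃ t, S.g.hom.app (op (U.isOpenEmbedding.isOpenMap.functor.obj ⊤)) t = s :=
    Sheaf.connectingHom_eq_zero_iff (J := Opens.grothendieckTopology U)
      (S := R) Limits.isTerminalTop hR s
  -- `U` and the image of `⊤ : Opens U` are not definitionally equal; with `W` a variable, the
  -- equation can be substituted.
  suffices h : ∀ W : Opens X, W = U.isOpenEmbedding.isOpenMap.functor.obj ⊤ →
      Nonempty ((S.X₃.obj.obj (op W) ⧸ (globalRes W S.X₃).hom.range) ≃+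
        Sheaf.H (U.sheafRestrict.obj S.X₁) 1) from h U hU
  rintro _ rfl
  refine nonempty_addEquiv_of_ker_eq (QuotientAddGroup.mk' _) δ
    (QuotientAddGroup.mk'_surjective _) hδ fun s ↦ ?_
  rw [hδ']
  refine (QuotientAddGroup.eq_zero_iff _).trans ?_
  -- Both subgroups are the image of `S.X₂(X)`: global sections of `S.X₃` lift by the choice of `x`,
  -- and sections of `S.X₂` extend by flasqueness.
  constructor
  · rintro ⟨t, rfl⟩
    obtain ⟨r, rfl⟩ := Sheaf.surjective_app_top_of_epi S.g hS.epi_g hx t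
    exact ⟨_, naturality_apply S.g le_top r⟩
  · rintro ⟨t, rfl⟩
    obtain ⟨r, rfl⟩ := (AddCommGrpCat.epi_iff_surjective _).mp
      (Presheaf.IsFlasque.epi (F := S.X₂.obj) (homOfLE (le_top :
        U.isOpenEmbedding.isOpenMap.functor.obj ⊤ ≤ ⊤)).op) t
    exact ⟨S.g.hom.app (op ⊤) r, (naturality_apply S.g le_top r).symm⟩

/-- The shift starts at `H¹` because flasque sheaves are acyclic only in positive degrees. -/
lemma nonempty_H_restrict_succ_addEquiv (U : Opens X)
    {S : ShortComplex (TopCat.Sheaf AddCommGrpCat.{u} X)} (hS : S.ShortExact) [IsFlasque S.X₂]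
    (n : ℕ) : Nonempty (Sheaf.H (U.sheafRestrict.obj S.X₃) (n + 1) ≃+
      Sheaf.H (U.sheafRestrict.obj S.X₁) (n + 2)) :=
  let R : ShortComplex (TopCat.Sheaf AddCommGrpCat.{u} (TopCat.of U)) := S.map (restrictOpens U)
  have hH (n : ℕ) : Subsingleton (Sheaf.H (U.sheafRestrict.obj S.X₂) (n + 1)) :=
    Sheaf.subsingleton_H_of_isFlasque (X := TopCat.of U) _
      (hF := isFlasque_restrictOpens U S.X₂) n
  @Sheaf.nonempty_H_succ_addEquiv _ _ (Opens.grothendieckTopology U) _ _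
    R (shortExact_map_restrictOpens U hS) (n + 1) (hH n) (hH (n + 1))

/-- A short exact sequence of cycles in an injective resolution shifts the cohomology of the cycles
down to the first cohomology. -/
lemma nonempty_H_restrict_cycles_addEquiv (U : Opens X) {F : TopCat.Sheaf AddCommGrpCat.{u} X}
    (I : InjectiveResolution F) (n k : ℕ) :
    Nonempty (Sheaf.H (U.sheafRestrict.obj (I.cocomplex.cycles (n + k))) 1 ≃+
      Sheaf.H (U.sheafRestrict.obj (I.cocomplex.cycles k)) (n + 1)) := by
  induction n generalizing k with
  | zero =>
    rw [zero_add]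
    exact ⟨AddEquiv.refl _⟩
  | succ n ih =>
    -- `e` reaches `Hⁿ⁺¹(U, Zᵏ⁺¹)`, and `e'` below passes from there to `Hⁿ⁺²(U, Zᵏ)`.
    obtain ⟨e⟩ := ih (k + 1)
    have : IsFlasque (HomologicalComplex.cyclesShortComplex I.cocomplex k).X₂ :=
      @isFlasque_of_injective _ _ (I.injective k)
    obtain ⟨e'⟩ := nonempty_H_restrict_succ_addEquiv U
      (HomologicalComplex.cyclesShortComplex_shortExact _ k (I.cocomplex_exactAt_succ k)) n
    rw [add_right_comm, add_assoc]
    exact ⟨e.trans e'⟩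

/-- The cokernel of the restriction map computes local cohomology on a space with a point whose only
open neighbourhood is the whole space. -/
lemma nonempty_sheafLocalCohomology_addEquiv (Z : Closeds X) {x : X}
    (hx : ∀ W : Opens X, x ∈ W → W = ⊤) {F : TopCat.Sheaf AddCommGrpCat.{u} X}
    (I : InjectiveResolution F) (n : ℕ) :
    Nonempty ((sheafLocalCohomology Z (n + 1)).obj F ≃+
      (I.cocomplex.cycles n).obj.obj (op Z.compl) ⧸
        (globalRes Z.compl (I.cocomplex.cycles n)).hom.range) := by
  have : IsFlasque (I.cocomplex.X n) := @isFlasque_of_injective _ _ (I.injective n)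
  let K := ((sectionsWithSupport Z).mapHomologicalComplex (ComplexShape.up ℕ)).obj I.cocomplex
  have hS := HomologicalComplex.cyclesShortComplex_shortExact _ n (I.cocomplex_exactAt_succ n)
  have hw : I.cocomplex.iCycles n ≫ I.cocomplex.d n (n + 1) = 0 := by simp
  obtain ⟨e⟩ := nonempty_homology_sectionsWithSupport_addEquiv Z
    (ShortComplex.mk (I.cocomplex.d n (n + 1)) (I.cocomplex.d (n + 1) (n + 2))
      (I.cocomplex.d_comp_d _ _ _)) (I.cocomplex.iCycles n) hw
    (ShortComplex.exact_of_f_is_kernel _ (I.cocomplex.cyclesIsKernel n (n + 1) (by simp)))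
    -- A global section killed by the differential lies in `Zⁿ⁺¹(X)`, and `Iⁿ ⟶ Zⁿ⁺¹` is surjective
    -- on global sections because of `x`.
    (fun b hb ↦ by
      obtain ⟨c, rfl⟩ := (exact_sections (I.cocomplex.iCycles (n + 1))
        (I.cocomplex.d (n + 1) (n + 2)) (by simp) (ShortComplex.exact_of_f_is_kernel _
          (I.cocomplex.cyclesIsKernel (n + 1) (n + 2) (by simp))) b).mp hb
      obtain ⟨a, rfl⟩ := Sheaf.surjective_app_top_of_epi
        (HomologicalComplex.cyclesShortComplex I.cocomplex n).g hS.epi_g hx c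
      refine ⟨a, ?_⟩
      change _ = (I.cocomplex.toCycles n (n + 1) ≫ I.cocomplex.iCycles (n + 1)).hom.app (op ⊤) a
      rw [HomologicalComplex.toCycles_i])
    ((AddCommGrpCat.epi_iff_surjective _).mp
      (Presheaf.IsFlasque.epi (F := (I.cocomplex.X n).obj) _))
  exact ⟨(I.isoRightDerivedObj (sectionsWithSupport Z) (n + 1) ≪≫
    ShortComplex.homologyMapIso (K.isoSc' n (n + 1) (n + 2) (by simp)
      (by simp))).addCommGroupIsoToAddEquiv.trans e⟩

end TopCat.Sheaf

namespace TopCat.Sheaf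
variable {X : TopCat.{u}}

lemma nonempty_coker_addEquiv_of_iso (U : Opens X) {F G : TopCat.Sheaf AddCommGrpCat.{u} X}
    (e : F ≅ G) : Nonempty ((F.obj.obj (op U) ⧸ (globalRes U F).hom.range) ≃+
      G.obj.obj (op U) ⧸ (globalRes U G).hom.range) := by
  have h (V : Opens X) (x : F.obj.obj (op V)) :
      e.inv.hom.app (op V) (e.hom.hom.app (op V) x) = x := by
    change (e.hom ≫ e.inv).hom.app (op V) x = x
    rw [e.hom_inv_id]
    rfl
  have h' (V : Opens X) (x : G.obj.obj (op V)) :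
      e.hom.hom.app (op V) (e.inv.hom.app (op V) x) = x := by
    change (e.inv ≫ e.hom).hom.app (op V) x = x
    rw [e.inv_hom_id]
    rfl
  refine nonempty_addEquiv_of_ker_eq (QuotientAddGroup.mk' _)
    ((QuotientAddGroup.mk' _).comp (e.hom.hom.app (op U)).hom) (QuotientAddGroup.mk'_surjective _)
    ((QuotientAddGroup.mk'_surjective _).comp fun x ↦ ⟨_, h' U x⟩) fun x ↦ ?_
  refine (QuotientAddGroup.eq_zero_iff _).trans (Iff.trans ?_
      (QuotientAddGroup.eq_zero_iff _).symm)
  constructor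
  · rintro ⟨y, rfl⟩
    exact ⟨e.hom.hom.app (op ⊤) y, (naturality_apply e.hom le_top y).symm⟩
  · rintro ⟨y, hy⟩
    refine ⟨e.inv.hom.app (op ⊤) y, (naturality_apply e.inv le_top y).symm.trans ?_⟩
    exact (congrArg (e.inv.hom.app (op U)) hy).trans (h U x)

/-- Isomorphic abelian sheaves have isomorphic cohomology on open subsets. -/
def hRestrictAddEquivOfIso (U : Opens X) {F G : TopCat.Sheaf AddCommGrpCat.{u} X}
    (e : F ≅ G) (n : ℕ) :
    Sheaf.H (U.sheafRestrict.obj F) n ≃+ Sheaf.H (U.sheafRestrict.obj G) n :=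
  Sheaf.hAddEquivOfIso (J := Opens.grothendieckTopology U)
    (((fullyFaithfulSheafToPresheaf _ _).preimageIso
      ((TopCat.Sheaf.forget AddCommGrpCat.{u} (TopCat.of U)).mapIso
        ((restrictOpens U).mapIso e)))) n

end TopCat.Sheaf

/-! ### Largest primes in open subsets of the spectrum -/

namespace PrimeSpectrum

variable {V : Type u} [CommRing V] [IsDomain V] [ValuationRing V]

/-- A nonempty open subset `U` of the spectrum of a valuation ring has a point contained in no
smaller open subset if `U` is quasi-compact or the ring has finite Krull dimension. -/
lemma exists_forall_mem_opens_eq_top (U : Opens (PrimeSpectrum V)) (hne : Nonempty U)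
    (h : ringKrullDim V < ⊤ ∨ IsCompact (U : Set (PrimeSpectrum V))) :
    ∃ x : U, ∀ W : Opens U, x ∈ W → W = ⊤ := by
  -- A maximal prime of `U` comes from the ascending chain condition on primes in finite dimension,
  -- and from a closed point of `U` in the quasi-compact case.
  obtain ⟨x, hx⟩ : ∃ x : U, ∀ y : U, x.1 ≤ y.1 → y = x := by
    rcases h with h | h
    · have : Order.krullDim (PrimeSpectrum V) ≠ ⊤ := h.ne
      have : FiniteDimensionalOrder (PrimeSpectrum V) :=
        Order.finiteDimensionalOrder_iff_krullDim_ne_bot_and_top.mpr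
          ⟨fun h ↦ (Order.krullDim_eq_bot_iff.mp h).false hne.some.1, this⟩
      obtain ⟨x, hxU, hx⟩ := WellFounded.has_min (SetRel.IsWellFounded.inv_of_finiteDimensional
        (r := {(a, b) : PrimeSpectrum V × PrimeSpectrum V | a < b}))
        (U : Set (PrimeSpectrum V)) ⟨_, hne.some.2⟩
      exact ⟨⟨x, hxU⟩, fun y hy ↦ Subtype.ext ((lt_or_eq_of_le hy).resolve_left (hx y.1 y.2)).symm⟩
    · have := isCompact_iff_compactSpace.mp h
      obtain ⟨x, -, hx⟩ := (isClosed_univ (X := U)).exists_closed_singleton ⟨hne.some, trivial⟩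
      refine ⟨x, fun y hy ↦ ?_⟩
      have : x ⤳ y := by
        rw [← Topology.IsInducing.subtypeVal.specializes_iff]
        exact (PrimeSpectrum.le_iff_specializes _ _).mp hy
      exact this.mem_closed hx rfl
  refine ⟨x, fun W hxW ↦ top_le_iff.mp fun y _ ↦ ?_⟩
  -- Ideals of `V` form a chain, so the maximal prime `x` contains every prime `y` of `U`; open sets
  -- are stable under generization.
  have hyx : y ⤳ x := by
    rw [← Topology.IsInducing.subtypeVal.specializes_iff]
    refine (PrimeSpectrum.le_iff_specializes _ _).mp ?_
    rcases total_of (α := Ideal V) (· ≤ ·) x.1.asIdeal y.1.asIdeal with hxy | hyx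
    · exact (congrArg Subtype.val (hx y hxy)).le
    · exact hyx
  exact hyx.mem_open W.isOpen hxW

end PrimeSpectrum

end

/-! ### Local cohomology over a valuation ring -/

theorem theorem6p1 (V : Type u) [CommRing V] [IsDomain V] [ValuationRing V]
    (Z : Closeds (TopCat.of (PrimeSpectrum V)))
    (F : TopCat.Sheaf AddCommGrpCat.{u} (TopCat.of (PrimeSpectrum V))) :
    (∀ i : ℕ, 1 < i →
      Nonempty ((sheafLocalCohomology Z i).obj F ≃+ Sheaf.H (Z.compl.sheafRestrict.obj F) (i - 1))) ∧
    Nonempty ((sheafLocalCohomology Z 1).obj F ≅ Limits.cokernel (globalRes Z.compl F)) ∧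
    ((ringKrullDim V < ⊤ ∨ IsCompact (Z.compl : Set (PrimeSpectrum V))) →
      ∀ i : ℕ, 1 < i → Limits.IsZero ((sheafLocalCohomology Z i).obj F)) := by
  let I : InjectiveResolution F := injectiveResolution F
  have hx : ∀ W : Opens (TopCat.of (PrimeSpectrum V)),
      (IsLocalRing.closedPoint V : TopCat.of (PrimeSpectrum V)) ∈ W → W = ⊤ := fun W hW ↦
    (IsLocalRing.closedPoint_mem_iff W).mp hW
  have hH (n : ℕ) : Nonempty ((sheafLocalCohomology Z (n + 2)).obj F ≃+
      Sheaf.H (Z.compl.sheafRestrict.obj F) (n + 1)) := by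
    have : TopCat.Sheaf.IsFlasque (HomologicalComplex.cyclesShortComplex I.cocomplex n).X₂ :=
      @TopCat.Sheaf.isFlasque_of_injective _ _ (I.injective n)
    -- The chain is `Hⁿ⁺²Γ_Z(F) ≅ coker(Zⁿ⁺¹(X) → Zⁿ⁺¹(U)) ≅ H¹(U, Zⁿ) ≅ Hⁿ⁺¹(U, Z⁰) ≅ Hⁿ⁺¹(U, F)`.
    obtain ⟨e₁⟩ := TopCat.Sheaf.nonempty_sheafLocalCohomology_addEquiv Z hx I (n + 1)
    obtain ⟨e₂⟩ := TopCat.Sheaf.nonempty_coker_addEquiv_H_one Z.compl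
      (HomologicalComplex.cyclesShortComplex_shortExact _ n (I.cocomplex_exactAt_succ n)) hx
    obtain ⟨e₃⟩ := TopCat.Sheaf.nonempty_H_restrict_cycles_addEquiv Z.compl I n 0
    let e₄ := TopCat.Sheaf.hRestrictAddEquivOfIso Z.compl I.isoCyclesZero (n + 1)
    exact ⟨e₁.trans (e₂.trans (e₃.trans e₄.symm))⟩
  refine ⟨fun i hi ↦ ?_, ?_, fun h i hi ↦ ?_⟩
  · obtain ⟨n, rfl⟩ := Nat.exists_eq_add_of_le' hi
    exact hH n
  · obtain ⟨e₁⟩ := TopCat.Sheaf.nonempty_sheafLocalCohomology_addEquiv Z hx I 0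
    obtain ⟨e₂⟩ := TopCat.Sheaf.nonempty_coker_addEquiv_of_iso Z.compl I.isoCyclesZero
    exact ⟨(e₁.trans e₂.symm).toAddCommGrpIso ≪≫
      (AddCommGrpCat.cokernelIsoQuotient (globalRes Z.compl F)).symm⟩
  · obtain ⟨n, rfl⟩ := Nat.exists_eq_add_of_le' hi
    obtain ⟨e⟩ := hH n
    have : Subsingleton (Sheaf.H (Z.compl.sheafRestrict.obj F) (n + 1)) := by
      -- An empty `U` has no largest prime and is treated separately.
      rcases isEmpty_or_nonempty Z.compl with hU | hU
      · have : IsEmpty (TopCat.of Z.compl) := hU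
        exact Sheaf.subsingleton_H_of_isEmpty (X := TopCat.of Z.compl) _ n
      · obtain ⟨x, hx⟩ := PrimeSpectrum.exists_forall_mem_opens_eq_top Z.compl hU h
        exact Sheaf.subsingleton_H_of_point (X := TopCat.of Z.compl) (x := x) hx _ n
    have := e.toEquiv.subsingleton
    exact AddCommGrpCat.isZero_of_subsingleton _
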